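/- Let $\mathbf{k}$ be a field, let $c\ge 1$ be an integer, and for $n\ge 1$ let $R_n=\mathbf{k}[x_{i,j} : 1\le i\le c,\ 1\le j\le n]$, so that $R_1\subseteq R_2\subseteq\cdots$. Let the symmetric group $\mathrm{Sym}(n)$ act on $R_n$ by $\mathbf{k}$-algebra automorphisms via $\sigma\cdot x_{i,j}=x_{i,\sigma(j)}$. Let $(I_n)_{n\ge 1}$ be a $\mathrm{Sym}$-invariant chain of squarefree monomial ideals, that is, each $I_n$ is an ideal of $R_n$ generated by squarefree monomials, and $\sigma(f)\in I_n$ whenever $1\le m\le n$, $f\in I_m$ and $\sigma\in\mathrm{Sym}(n)$. Then the number of $\mathrm{Sym}(n)$-orbits of prime components (associated primes) $P$ of $I_n$ with $\operatorname{ht}(P)=\operatorname{ht}(I_n)$ is eventually a polynomial in $n$: there are a polynomial $p\in\mathbb{Q}[t]$ and an integer $N$ such that for all $n\ge N$ this number is finite and equal to $p(n)$. -/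

import Mathlib

namespace SymChain

/-- The polynomial ring `R_n = k[x_{i,j} : i ∈ [c], j ∈ [n]]`. -/
abbrev PolyRing (k : Type*) [Field k] (c n : ℕ) : Type _ :=
  MvPolynomial (Fin c × Fin n) k

/-- The inclusion `R_m ⊆ R_n` for `m ≤ n`, sending `x_{i,j}` to `x_{i,j}`. -/
noncomputable def incl (k : Type*) [Field k] (c : ℕ) {m n : ℕ} (h : m ≤ n) :
    PolyRing k c m →ₐ[k] PolyRing k c n :=
  MvPolynomial.rename (Prod.map id (Fin.castLE h))

/-- The action of `σ ∈ Sym(n)` on `R_n`, given by `σ · x_{i,j} = x_{i,σ(j)}`. -/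
noncomputable def act (k : Type*) [Field k] (c : ℕ) {n : ℕ} (σ : Equiv.Perm (Fin n)) :
    PolyRing k c n →ₐ[k] PolyRing k c n :=
  MvPolynomial.rename (Prod.map id σ)

/-- An ideal generated by squarefree monomials (i.e. products of distinct variables). -/
def IsSquarefreeMonomial {k : Type*} [Field k] {c n : ℕ} (I : Ideal (PolyRing k c n)) : Prop :=
  ∃ S : Set (Finset (Fin c × Fin n)),
    I = Ideal.span ((fun s => ∏ v ∈ s, (MvPolynomial.X v : PolyRing k c n)) '' S)

/-- `(I_n)_{n ≥ 1}` is a `Sym`-invariant chain: `Sym(n)(I_m) ⊆ I_n` whenever `1 ≤ m ≤ n`.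
The value at `n = 0` plays no role. -/
def IsSymInvariantChain {k : Type*} [Field k] {c : ℕ}
    (I : (n : ℕ) → Ideal (PolyRing k c n)) : Prop :=
  ∀ (m n : ℕ) (h : m ≤ n), 1 ≤ m →
    ∀ (σ : Equiv.Perm (Fin n)), ∀ f ∈ I m, act k c σ (incl k c h f) ∈ I n

/-- The `Sym(n)`-orbit of an ideal `P` of `R_n`, where `σ` sends `P` to `σ(P)`. -/
def idealOrbit {k : Type*} [Field k] {c n : ℕ} (P : Ideal (PolyRing k c n)) :
    Set (Ideal (PolyRing k c n)) :=
  Set.range fun σ : Equiv.Perm (Fin n) => P.map (act k c σ)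

/-- The prime components (associated primes) of `I` whose height equals the height of `I`. -/
def minHeightComponents {k : Type*} [Field k] {c n : ℕ} (I : Ideal (PolyRing k c n)) :
    Set (Ideal (PolyRing k c n)) :=
  {P | P ∈ associatedPrimes (PolyRing k c n) (PolyRing k c n ⧸ I) ∧ P.height = I.height}

/-- The set of `Sym(n)`-orbits of prime components of `I` of height equal to that of `I`. -/
def minHeightComponentOrbits {k : Type*} [Field k] {c n : ℕ} (I : Ideal (PolyRing k c n)) :
    Set (Set (Ideal (PolyRing k c n))) :=
  idealOrbit '' minHeightComponents I

end SymChain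

namespace SymChain
open MvPolynomial

/-! The associated primes of a squarefree monomial ideal having its height are generated by vertex
covers of least size (`associated_height_eq_iff`). Label each column by the rows missing from the
cover. An orbit is then the vector `a` counting how often each subset of `Fin c` occurs as a label
(`idealOrbit_varIdeal_eq_iff`), and the size of the cover is the linear form `∑ s, a s * (c -
s.card)`. A set is a cover iff the product of the variables outside it is not in the ideal. By the
chain condition the counts of squarefree monomials in the ideals form one upper set `U`, independent
of `n` (`isUpperSet_monomialCounts`). So the orbits are the points outside `U` with sum `n` and
least weight.

To count these, Dickson's lemma makes membership in `U` depend only on the truncation of `a` at some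
`N`. Points with truncation `t` are `t + e` with `e` supported where `t = N`. Their least weight is
linear in `n`, attained exactly when `e` lives on the lightest of these coordinates, which leaves a
binomial coefficient of choices. For large `n` the same truncations win, so the count is a fixed sum
of binomial polynomials. -/

/-- The ideal generated by a set of variables. -/
noncomputable def varIdeal (k : Type*) [Field k] {τ : Type*} (C : Finset τ) :
    Ideal (MvPolynomial τ k) :=
  Ideal.span ((X : τ → MvPolynomial τ k) '' (C : Set τ))

/-! ### Primes generated by variables, and vertex covers. -/

section varIdeal

variable {k : Type*} [Field k] {τ : Type*}

theorem varIdeal_le_iff {C : Finset τ} {P : Ideal (MvPolynomial τ k)} :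
    varIdeal k C ≤ P ↔ ∀ v ∈ C, (X v : MvPolynomial τ k) ∈ P := by
  rw [varIdeal, Ideal.span_le, Set.image_subset_iff]
  rfl

theorem varIdeal_eq_ker [DecidableEq τ] (C : Finset τ) :
    varIdeal k C = RingHom.ker
      (aeval (fun v => if v ∈ C then 0 else X v) : MvPolynomial τ k →ₐ[k] MvPolynomial τ k) := by
  set φ : MvPolynomial τ k →ₐ[k] MvPolynomial τ k :=
    aeval (fun v => if v ∈ C then 0 else X v) with hφ
  apply le_antisymm
  · rw [varIdeal_le_iff]
    intro v hv
    simp [hφ, RingHom.mem_ker, hv]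
  · intro f hf
    -- Killing the variables of `C` changes nothing modulo the ideal they generate.
    have key : (Ideal.Quotient.mkₐ k (varIdeal k C)).comp φ
        = Ideal.Quotient.mkₐ k (varIdeal k C) := by
      ext v
      by_cases hv : v ∈ C
      · have : (X v : MvPolynomial τ k) ∈ varIdeal k C := varIdeal_le_iff.1 le_rfl v hv
        simp [hφ, hv, Ideal.Quotient.eq_zero_iff_mem.2 this]
      · simp [hφ, hv]
    have h := DFunLike.congr_fun key f
    rw [RingHom.mem_ker] at hf
    have hf' : φ f = 0 := hf
    rw [AlgHom.comp_apply, hf', map_zero] at h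
    exact Ideal.Quotient.eq_zero_iff_mem.1 h.symm

instance varIdeal_isPrime (C : Finset τ) : (varIdeal k C).IsPrime := by
  classical
  rw [varIdeal_eq_ker]
  exact RingHom.ker_isPrime _

theorem X_mem_varIdeal {C : Finset τ} {v : τ} :
    (X v : MvPolynomial τ k) ∈ varIdeal k C ↔ v ∈ C := by
  classical
  refine ⟨fun h => ?_, fun h => varIdeal_le_iff.1 le_rfl v h⟩
  by_contra hv
  rw [varIdeal_eq_ker, RingHom.mem_ker] at h
  simp [hv] at h

theorem varIdeal_le_varIdeal {C D : Finset τ} : varIdeal k C ≤ varIdeal k D ↔ C ⊆ D := by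
  simp [varIdeal_le_iff, X_mem_varIdeal, Finset.subset_iff]

theorem varIdeal_injective : Function.Injective (varIdeal k : Finset τ → _) := fun _ _ h =>
  Finset.Subset.antisymm (varIdeal_le_varIdeal.1 h.le) (varIdeal_le_varIdeal.1 h.ge)

/-- Krull's height theorem bounds it above; adding one variable at a time gives a strict chain of
primes below. -/
theorem varIdeal_height [Finite τ] (C : Finset τ) : (varIdeal k C).height = C.card := by
  classical
  apply le_antisymm
  · have h : varIdeal k C ∈ (Ideal.span (C.image (X : τ → MvPolynomial τ k) :
        Set (MvPolynomial τ k))).minimalPrimes := by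
      rw [Finset.coe_image]
      change _ ∈ (varIdeal k C).minimalPrimes
      simp [Ideal.minimalPrimes_eq_subsingleton_self]
    refine (Ideal.height_le_card_of_mem_minimalPrimes_span_finset h).trans ?_
    exact_mod_cast Finset.card_image_le
  · induction C using Finset.induction_on with
    | empty => simp
    | insert v C hv ih =>
      rw [Finset.card_insert_of_notMem hv]
      have hlt : varIdeal k C < varIdeal k (insert v C) :=
        lt_of_le_not_ge (varIdeal_le_varIdeal.2 (Finset.subset_insert v C)) fun h =>
          hv (varIdeal_le_varIdeal.1 h (Finset.mem_insert_self v C))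
      push_cast
      exact (add_le_add_left ih 1).trans (Ideal.height_add_one_le_of_lt_of_isPrime hlt)

theorem varIdeal_map_rename [DecidableEq τ] (e : τ ≃ τ) (C : Finset τ) :
    (varIdeal k C).map (rename e : MvPolynomial τ k →ₐ[k] MvPolynomial τ k) =
      varIdeal k (C.map e.toEmbedding) := by
  rw [varIdeal, Ideal.map_span, varIdeal, ← Set.image_comp, Finset.coe_map, ← Set.image_comp]
  congr 2
  ext v
  simp

/-- For an ideal generated by squarefree monomials, the primes over it of the same height that are
associated are the ideals generated by the vertex covers of minimal cardinality. -/
theorem associated_height_eq_iff [Finite τ] {I : Ideal (MvPolynomial τ k)}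
    {S : Set (Finset τ)}
    (hS : I = Ideal.span ((fun s => ∏ v ∈ s, (X v : MvPolynomial τ k)) '' S))
    (P : Ideal (MvPolynomial τ k)) :
    (P ∈ associatedPrimes (MvPolynomial τ k) (MvPolynomial τ k ⧸ I) ∧ P.height = I.height) ↔
      ∃ C : Finset τ, varIdeal k C = P ∧ I ≤ varIdeal k C ∧
        ∀ D : Finset τ, I ≤ varIdeal k D → C.card ≤ D.card := by
  classical
  have := Fintype.ofFinite τ
  -- The variables lying in `P` form a cover, since a prime containing a monomial contains one of
  -- its variables.
  have cover : ∀ P : Ideal (MvPolynomial τ k), P.IsPrime → I ≤ P →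
      ∃ C : Finset τ, I ≤ varIdeal k C ∧ varIdeal k C ≤ P := by
    intro P hP hIP
    refine ⟨Finset.univ.filter fun v => (X v : MvPolynomial τ k) ∈ P, ?_,
      varIdeal_le_iff.2 fun v hv => (Finset.mem_filter.1 hv).2⟩
    rw [hS, Ideal.span_le]
    rintro _ ⟨s, hs, rfl⟩
    have : ∏ v ∈ s, (X v : MvPolynomial τ k) ∈ P :=
      hIP (hS ▸ Ideal.subset_span ⟨s, hs, rfl⟩)
    obtain ⟨v, hv, hvP⟩ := (hP.prod_mem_iff).1 this
    exact Ideal.mem_of_dvd _ (Finset.dvd_prod_of_mem _ hv)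
      (X_mem_varIdeal.2 (by simpa using hvP))
  constructor
  · rintro ⟨hass, hht⟩
    have hP : P.IsPrime := hass.isPrime
    have hIP : I ≤ P := by
      have := IsAssociatedPrime.annihilator_le (R := MvPolynomial τ k) hass
      rwa [Submodule.annihilator_top, Ideal.annihilator_quotient] at this
    obtain ⟨C, hIC, hCP⟩ := cover P hP hIP
    have hCP' : varIdeal k C = P := by
      refine eq_of_le_of_not_lt hCP fun hlt => ?_
      have h1 := Ideal.height_strict_mono_of_isPrime_of_isPrime hlt
      exact (h1.trans_le (hht.le.trans (Ideal.height_mono hIC))).false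
    refine ⟨C, hCP', hIC, fun D hD => ?_⟩
    have := Ideal.height_mono hD
    rw [← hht, ← hCP', varIdeal_height, varIdeal_height] at this
    exact_mod_cast this
  · rintro ⟨C, rfl, hIC, hmin⟩
    have hht : (varIdeal k C).height ≤ I.height := by
      rw [I.height_eq_inf_minimalPrimes]
      refine le_iInf₂ fun Q hQ => ?_
      obtain ⟨D, hID, hDQ⟩ := cover Q hQ.1.1 hQ.1.2
      refine le_trans ?_ (Ideal.height_mono hDQ)
      rw [varIdeal_height, varIdeal_height]
      exact_mod_cast hmin D hID
    refine ⟨?_, le_antisymm hht (Ideal.height_mono hIC)⟩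
    apply Module.associatedPrimes.minimalPrimes_annihilator_subset_associatedPrimes
    rw [Ideal.annihilator_quotient]
    exact Ideal.mem_minimalPrimes_of_height_le hIC hht

/-- A generator escapes `varIdeal k C` exactly when its support avoids `C`, that is, when it divides
the product over `Cᶜ`. -/
theorem le_varIdeal_iff [Fintype τ] [DecidableEq τ] {I : Ideal (MvPolynomial τ k)}
    {S : Set (Finset τ)}
    (hS : I = Ideal.span ((fun s => ∏ v ∈ s, (X v : MvPolynomial τ k)) '' S)) (C : Finset τ) :
    I ≤ varIdeal k C ↔ ∏ v ∈ Cᶜ, (X v : MvPolynomial τ k) ∉ I := by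
  constructor
  · intro h hmem
    obtain ⟨v, hv, hvC⟩ := ((varIdeal_isPrime C).prod_mem_iff).1 (h hmem)
    exact Finset.mem_compl.1 hv (X_mem_varIdeal.1 hvC)
  · intro h
    rw [hS, Ideal.span_le]
    rintro _ ⟨s, hs, rfl⟩
    by_contra hsC
    refine h (Ideal.mem_of_dvd I (Finset.prod_dvd_prod_of_subset s Cᶜ _ fun v hv => ?_)
      (hS ▸ Ideal.subset_span ⟨s, hs, rfl⟩))
    rw [Finset.mem_compl]
    exact fun hvC => hsC (Ideal.mem_of_dvd _ (Finset.dvd_prod_of_mem _ hv)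
      (X_mem_varIdeal.2 hvC))

end varIdeal

/-! ### Counting points of least weight outside an upper set. -/

section counting
open Finset Filter

variable {σ : Type*}

theorem min_add_of_support {N : ℕ} {t e : σ → ℕ} (ht : ∀ s, t s ≤ N) (he : ∀ s, e s ≠ 0 → t s = N) :
    (fun s => min ((t + e) s) N) = t := by
  funext s
  have := ht s
  have := he s
  simp only [Pi.add_apply]
  omega

theorem exists_add_of_min_eq {N : ℕ} {t a : σ → ℕ} (ha : (fun s => min (a s) N) = t) :
    ∃ e : σ → ℕ, a = t + e ∧ ∀ s, e s ≠ 0 → t s = N := by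
  subst ha
  refine ⟨fun s => a s - N, ?_, fun s => ?_⟩
  · funext s; simp only [Pi.add_apply]; omega
  · simp only; omega

theorem card_piAntidiag [DecidableEq σ] (K : Finset σ) (hK : K.Nonempty) (m : ℕ) :
    (piAntidiag K m).card = (m + (K.card - 1)).choose (K.card - 1) := by
  have h : (piAntidiag K m).card = (finsuppAntidiag K m).card := by simp [finsuppAntidiag]
  have := hK.card_pos
  rw [h, card_finsuppAntidiag_nat_eq_choose, ← Nat.choose_symm (by omega)]
  congr 1 <;> omega

variable [Fintype σ]

/-- Membership in an upper set of `ℕ^σ` depends only on a truncation of the coordinates. -/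
theorem exists_truncation {U : Set (σ → ℕ)} (hU : IsUpperSet U) :
    ∃ N : ℕ, ∀ a : σ → ℕ, a ∈ U ↔ (fun s => min (a s) N) ∈ U := by
  have hfin : {u | Minimal (· ∈ U) u}.Finite :=
    WellQuasiOrderedLE.finite_of_isAntichain (setOfPred_minimal_antichain _)
  refine ⟨hfin.toFinset.sup fun u => univ.sup u, fun a =>
    ⟨fun ha => ?_, fun ha => hU (fun s => min_le_left _ _) ha⟩⟩
  obtain ⟨u, hua, hu⟩ := exists_minimal_le_of_wellFoundedLT (· ∈ U) a ha
  refine hU (fun s => le_min (hua s) ?_) hu.prop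
  exact (le_sup (f := u) (mem_univ s)).trans
    (le_sup (f := fun u : σ → ℕ => univ.sup u) (hfin.mem_toFinset.2 hu))

theorem exists_eventually_linear_le_iff (α β α' β' : ℤ) :
    ∃ p : Prop, ∀ᶠ n : ℕ in atTop, (α + n * β ≤ α' + n * β' ↔ p) := by
  rcases lt_trichotomy β β' with h | h | h
  · refine ⟨True, eventually_atTop.2 ⟨(α - α').toNat, fun n hn => iff_true_intro ?_⟩⟩
    have : α - α' ≤ n := by omega
    nlinarith
  · exact ⟨α ≤ α', by simp [h]⟩
  · refine ⟨False, eventually_atTop.2 ⟨(α' - α).toNat + 1, fun n hn => iff_false_intro ?_⟩⟩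
    have : α' - α < n := by omega
    nlinarith

section pieces

variable (w : σ → ℕ) (N : ℕ) (t : σ → ℕ)

/-- The coordinates at which `t` attains the value `N` and where `w` is minimal among those. -/
def lightSupport : Finset σ :=
  univ.filter fun s => t s = N ∧ ∀ s', t s' = N → w s ≤ w s'

variable {w N t}

theorem lightSupport_nonempty (h : ∃ s, t s = N) : (lightSupport w N t).Nonempty := by
  obtain ⟨s, hs, hmin⟩ := exists_min_image (univ.filter fun s => t s = N) w
    (by simpa [Finset.Nonempty] using h)
  exact ⟨s, by simpa [lightSupport] using ⟨by simpa using hs, by simpa using hmin⟩⟩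

/-- The least weight `∑ s, a s * w s` over the `a` with sum `n` that truncate to `t`. -/
def minWeight (w : σ → ℕ) (s₀ : σ) (t : σ → ℕ) (n : ℕ) : ℤ :=
  (∑ s, (t s : ℤ) * w s - (∑ s, (t s : ℤ)) * w s₀) + n * w s₀

/-- With `a = t + e`, the excess weight is `∑ s, e s * (w s - w s₀)`. Its terms are nonnegative
because `e` is supported where `t = N`, and they all vanish iff `e` is supported on the light
coordinates. -/
theorem minWeight_le {s₀ : σ} (h₀ : s₀ ∈ lightSupport w N t) {a : σ → ℕ}
    (ha : (fun s => min (a s) N) = t) :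
    minWeight w s₀ t (∑ s, a s) ≤ ∑ s, (a s : ℤ) * w s ∧
      ((∑ s, (a s : ℤ) * w s = minWeight w s₀ t (∑ s, a s)) ↔
        ∀ s, a s ≠ t s → s ∈ lightSupport w N t) := by
  obtain ⟨e, rfl, he⟩ := exists_add_of_min_eq ha
  simp only [lightSupport, mem_filter, mem_univ, true_and] at h₀ ⊢
  have key : ∑ s, (((t + e) s : ℕ) : ℤ) * w s - minWeight w s₀ t (∑ s, (t + e) s) =
      ∑ s, (e s : ℤ) * ((w s : ℤ) - w s₀) := by
    simp only [minWeight, Pi.add_apply, Nat.cast_add, Nat.cast_sum, sum_add_distrib, add_mul,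
      mul_sub, sum_sub_distrib, sum_mul]
    ring
  have hnn : ∀ s ∈ univ, 0 ≤ (e s : ℤ) * ((w s : ℤ) - w s₀) := by
    intro s _
    by_cases hs : e s = 0
    · simp [hs]
    · have := h₀.2 s (he s hs)
      exact mul_nonneg (by positivity) (by omega)
  have h1 := sum_nonneg hnn
  refine ⟨by omega, ?_⟩
  rw [← sub_eq_zero, key, sum_eq_zero_iff_of_nonneg hnn]
  simp only [mem_univ, forall_const, mul_eq_zero, Nat.cast_eq_zero, Pi.add_apply]
  refine forall_congr' fun s => ?_
  constructor
  · intro h hs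
    have hes : e s ≠ 0 := by omega
    refine ⟨he s hes, fun s' hs' => ?_⟩
    have := h₀.2 s' hs'
    have := h.resolve_left hes
    omega
  · intro h
    by_cases hs : e s = 0
    · exact Or.inl hs
    · have h2 := h (by omega)
      have := h₀.2 s h2.1
      have := h2.2 s₀ h₀.1
      right; omega

theorem mem_image_add_piAntidiag_iff [DecidableEq σ] {s₀ : σ} (h₀ : s₀ ∈ lightSupport w N t)
    (ht : ∀ s, t s ≤ N) {n : ℕ} (hn : ∑ s, t s ≤ n) (a : σ → ℕ) :
    a ∈ (piAntidiag (lightSupport w N t) (n - ∑ s, t s)).image (t + ·) ↔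
      (fun s => min (a s) N) = t ∧ ∑ s, a s = n ∧
        ∑ s, (a s : ℤ) * w s = minWeight w s₀ t n := by
  have hsub : ∀ s ∈ lightSupport w N t, t s = N := fun s hs => by
    simp only [lightSupport, mem_filter] at hs
    exact hs.2.1
  constructor
  · intro h
    obtain ⟨e, he, rfl⟩ := mem_image.1 h
    rw [mem_piAntidiag] at he
    have htr := min_add_of_support ht fun s hs => hsub s (he.2 s hs)
    have hsum : ∑ s, (t + e) s = n := by
      have : ∑ s, e s = (lightSupport w N t).sum e :=
        (sum_subset (subset_univ _) fun s _ hs => by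
          by_contra h; exact hs (he.2 s h)).symm
      simp only [Pi.add_apply, sum_add_distrib]
      omega
    refine ⟨htr, hsum, ?_⟩
    rw [← hsum, (minWeight_le h₀ htr).2]
    intro s hs
    exact he.2 s fun h => hs (by simp [h])
  · rintro ⟨htr, rfl, hw⟩
    have hlight := (minWeight_le h₀ htr).2.1 hw
    obtain ⟨e, rfl, he⟩ := exists_add_of_min_eq htr
    have hsupp : ∀ s, e s ≠ 0 → s ∈ lightSupport w N t := fun s hs =>
      hlight s (by simpa using hs)
    refine mem_image.2 ⟨e, mem_piAntidiag.2 ⟨?_, hsupp⟩, rfl⟩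
    rw [sum_subset (subset_univ _) fun s _ hs => by
          by_contra h; exact hs (hsupp s h)]
    simp [sum_add_distrib]

end pieces

/-- The number of points of a lower set of `ℕ^σ` of given coordinate sum and minimal weight
is eventually polynomial in the sum. -/
theorem exists_polynomial_card_minimal_weight [DecidableEq σ] {U : Set (σ → ℕ)} (hU : IsUpperSet U)
    (w : σ → ℕ) :
    ∃ p : Polynomial ℚ, ∃ n₀ : ℕ, ∀ n, n₀ ≤ n →
      {a : σ → ℕ | a ∉ U ∧ ∑ s, a s = n ∧
        ∀ b ∉ U, ∑ s, b s = n → ∑ s, a s * w s ≤ ∑ s, b s * w s}.Finite ∧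
      ({a : σ → ℕ | a ∉ U ∧ ∑ s, a s = n ∧
        ∀ b ∉ U, ∑ s, b s = n → ∑ s, a s * w s ≤ ∑ s, b s * w s}.ncard : ℚ) =
          p.eval (n : ℚ) := by
  classical
  obtain ⟨N, hN⟩ := exists_truncation hU
  -- A truncation that never reaches `N` only accounts for points of sum at most `Fintype.card σ *
  -- N`, so it is dropped.
  let A : Finset (σ → ℕ) := (Fintype.piFinset fun _ => range (N + 1)).filter fun t =>
    t ∉ U ∧ ∃ s, t s = N
  have hA : ∀ t, t ∈ A ↔ (∀ s, t s ≤ N) ∧ t ∉ U ∧ ∃ s, t s = N := by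
    intro t
    simp [A]
  have hℓ : ∀ t : σ → ℕ, ∃ αβ : ℤ × ℤ, t ∈ A → ∃ s₀ ∈ lightSupport w N t,
      ∀ n : ℕ, minWeight w s₀ t n = αβ.1 + n * αβ.2 := by
    intro t
    by_cases ht : t ∈ A
    · obtain ⟨s, hs⟩ := lightSupport_nonempty (w := w) ((hA t).1 ht).2.2
      exact ⟨(_, _), fun _ => ⟨s, hs, fun n => rfl⟩⟩
    · exact ⟨0, fun h => absurd h ht⟩
  choose αβ hαβ using hℓ
  choose p hp using fun t t' : σ → ℕ =>
    exists_eventually_linear_le_iff (αβ t).1 (αβ t).2 (αβ t').1 (αβ t').2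
  -- The truncations whose linear least weight is eventually smallest.
  let B := A.filter fun t => ∀ t' ∈ A, p t t'
  have hev : ∀ᶠ n : ℕ in atTop, (∀ t ∈ A, ∀ t' ∈ A,
      ((αβ t).1 + n * (αβ t).2 ≤ (αβ t').1 + n * (αβ t').2 ↔ p t t')) := by
    simp only [Filter.eventually_all_finset]
    exact fun t _ t' _ => hp t t'
  obtain ⟨n₁, hn₁⟩ := eventually_atTop.1 hev
  -- Each summand counts the ways to distribute `n - ∑ s, t s` over the light coordinates. The
  -- second bound on `n` forces some coordinate to reach `N`.
  refine ⟨∑ t ∈ B, Polynomial.preHilbertPoly ℚ ((lightSupport w N t).card - 1) (∑ s, t s),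
    max n₁ (Fintype.card σ * N + 1), fun n hn => ?_⟩
  have hcmp := hn₁ n (le_of_max_le_left hn)
  have hn' : Fintype.card σ * N + 1 ≤ n := le_of_max_le_right hn
  have hsum_le : ∀ t : σ → ℕ, (∀ s, t s ≤ N) → ∑ s, t s ≤ Fintype.card σ * N := fun t ht => by
    simpa using sum_le_card_nsmul univ t N fun s _ => ht s
  have hmem : ∀ t ∈ A, ∀ a : σ → ℕ,
      a ∈ (piAntidiag (lightSupport w N t) (n - ∑ s, t s)).image (t + ·) ↔
        (fun s => min (a s) N) = t ∧ ∑ s, a s = n ∧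
          ∑ s, (a s : ℤ) * w s = (αβ t).1 + n * (αβ t).2 := by
    intro t ht a
    obtain ⟨s₀, h₀, hlin⟩ := hαβ t ht
    have ht' := (hA t).1 ht
    rw [mem_image_add_piAntidiag_iff h₀ ht'.1 (by have := hsum_le t ht'.1; omega), hlin]
  have hlow : ∀ a : σ → ℕ, a ∉ U → ∑ s, a s = n → (fun s => min (a s) N) ∈ A ∧
      (αβ fun s => min (a s) N).1 + n * (αβ fun s => min (a s) N).2 ≤
        ∑ s, (a s : ℤ) * w s := by
    intro a ha hsum
    have hmA : (fun s => min (a s) N) ∈ A := by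
      refine (hA _).2 ⟨fun s => min_le_right _ _, fun h => ha ((hN a).2 h), ?_⟩
      by_contra! h
      have := hsum_le a fun s => by have := h s; omega
      omega
    obtain ⟨s₀, h₀, hlin⟩ := hαβ _ hmA
    refine ⟨hmA, ?_⟩
    rw [← hlin, ← hsum]
    exact (minWeight_le h₀ rfl).1
  have hattain : ∀ t ∈ A, ∃ a : σ → ℕ, a ∉ U ∧ (fun s => min (a s) N) = t ∧ ∑ s, a s = n ∧
      ∑ s, (a s : ℤ) * w s = (αβ t).1 + n * (αβ t).2 := by
    intro t ht
    have ht' := (hA t).1 ht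
    obtain ⟨e, he⟩ : (piAntidiag (lightSupport w N t) (n - ∑ s, t s)).Nonempty := by
      rw [← card_pos, card_piAntidiag _ (lightSupport_nonempty ht'.2.2)]
      exact Nat.choose_pos (by omega)
    have h := (hmem t ht _).1 (mem_image_of_mem _ he)
    exact ⟨t + e, fun hU' => ht'.2.1 (h.1 ▸ (hN _).1 hU'), h⟩
  have hset : {a : σ → ℕ | a ∉ U ∧ ∑ s, a s = n ∧
        ∀ b ∉ U, ∑ s, b s = n → ∑ s, a s * w s ≤ ∑ s, b s * w s} =
      (B.biUnion fun t =>
        (piAntidiag (lightSupport w N t) (n - ∑ s, t s)).image (t + ·) : Finset (σ → ℕ)) := by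
    ext a
    simp only [Set.mem_ofPred_eq, mem_coe, mem_biUnion]
    constructor
    · rintro ⟨haU, hsum, hmin⟩
      obtain ⟨hmA, hle⟩ := hlow a haU hsum
      have hmin' : ∀ t ∈ A, ∑ s, (a s : ℤ) * w s ≤ (αβ t).1 + n * (αβ t).2 := by
        intro t ht
        obtain ⟨b, hbU, -, hbsum, hbw⟩ := hattain t ht
        rw [← hbw]
        exact_mod_cast hmin b hbU hbsum
      refine ⟨_, mem_filter.2 ⟨hmA, fun t' ht' => ?_⟩,
        (hmem _ hmA a).2 ⟨rfl, hsum, le_antisymm (hmin' _ hmA) hle⟩⟩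
      exact (hcmp _ hmA t' ht').1 (hle.trans (hmin' t' ht'))
    · rintro ⟨t, htB, hat⟩
      obtain ⟨htA, htp⟩ := mem_filter.1 htB
      obtain ⟨htr, hsum, hw⟩ := (hmem t htA a).1 hat
      refine ⟨fun haU => ((hA t).1 htA).2.1 (htr ▸ (hN a).1 haU), hsum, fun b hbU hbsum => ?_⟩
      obtain ⟨hbA, hble⟩ := hlow b hbU hbsum
      have := ((hcmp t htA _ hbA).2 (htp _ hbA)).trans hble
      rw [← hw] at this
      exact_mod_cast this
  rw [hset]
  refine ⟨finite_toSet _, ?_⟩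
  rw [Set.ncard_coe_finset, card_biUnion, Nat.cast_sum, Polynomial.eval_finsetSum]
  · refine sum_congr rfl fun t ht => ?_
    have ht' := (hA t).1 (mem_filter.1 ht).1
    rw [card_image_of_injective _ (add_right_injective t),
      card_piAntidiag _ (lightSupport_nonempty ht'.2.2),
      Polynomial.preHilbertPoly_eq_choose_sub_add]
    have := hsum_le t ht'.1
    omega
  · intro t ht t' ht' hne
    refine Finset.disjoint_left.2 fun a ha ha' => hne ?_
    rw [← ((hmem t (mem_filter.1 ht).1 a).1 ha).1, ((hmem t' (mem_filter.1 ht').1 a).1 ha').1]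

end counting

/-! ### Labelings of `Fin n` up to permutation. -/

section labelings

variable {α : Type*} [DecidableEq α]

/-- The number of times each label is used by a labeling of `Fin n`. -/
def labelCount {n : ℕ} (L : Fin n → α) (s : α) : ℕ :=
  (Finset.univ.filter fun j => L j = s).card

theorem sum_labelCount_mul [Fintype α] {n : ℕ} (L : Fin n → α) (f : α → ℕ) :
    ∑ s, labelCount L s * f s = ∑ j, f (L j) := by
  rw [← Finset.sum_fiberwise Finset.univ L]
  refine Finset.sum_congr rfl fun s _ => ?_
  rw [Finset.sum_congr rfl (g := fun _ => f s)
    fun j hj => by rw [(Finset.mem_filter.1 hj).2]]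
  simp [labelCount]

theorem sum_labelCount [Fintype α] {n : ℕ} (L : Fin n → α) : ∑ s, labelCount L s = n := by
  simpa using sum_labelCount_mul L fun _ => 1

theorem exists_labelCount_eq [Fintype α] (a : α → ℕ) :
    ∃ L : Fin (∑ s, a s) → α, labelCount L = a := by
  let e : Fin (∑ s, a s) ≃ Σ s, Fin (a s) := (Fintype.equivFinOfCardEq (by simp)).symm
  refine ⟨fun j => (e j).1, funext fun s => ?_⟩
  have h : (Finset.univ.filter fun j => (e j).1 = s).map e.toEmbedding =
      Finset.univ.map ⟨fun i : Fin (a s) => (⟨s, i⟩ : Σ s, Fin (a s)),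
        fun i i' h => by simpa using h⟩ := by
    ext x
    obtain ⟨j, rfl⟩ := e.surjective x
    simp only [Finset.mem_filter, Finset.mem_univ, true_and, Finset.mem_map,
      Function.Embedding.coeFn_mk, EmbeddingLike.apply_eq_iff_eq,
      exists_eq_right]
    constructor
    · rintro rfl; exact ⟨(e j).2, rfl⟩
    · rintro ⟨_, h⟩; exact congrArg Sigma.fst h.symm
  have := congrArg Finset.card h
  simpa [labelCount] using this

/-- Injections between the fibres over each label glue to an injection `Fin m → Fin n`, which
extends to a permutation. -/
theorem exists_perm_of_labelCount_le {m n : ℕ} (h : m ≤ n) {L : Fin m → α} {L' : Fin n → α}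
    (hle : labelCount L ≤ labelCount L') :
    ∃ σ : Equiv.Perm (Fin n), ∀ j, L' (σ (Fin.castLE h j)) = L j := by
  have hemb : ∀ s, Nonempty ({j // L j = s} ↪ {j // L' j = s}) := fun s =>
    Function.Embedding.nonempty_of_card_le (by
      simpa [labelCount, Fintype.card_subtype] using hle s)
  let e := fun s => (hemb s).some
  let g : Fin m → Fin n := fun j => (e (L j) ⟨j, rfl⟩).1
  have hg : ∀ j, L' (g j) = L j := fun j => (e (L j) ⟨j, rfl⟩).2
  have hinj : Function.Injective g := by
    have aux : ∀ (s) (i j : Fin m) (hi : L i = s) (hj : L j = s),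
        (e s ⟨i, hi⟩).1 = (e s ⟨j, hj⟩).1 → i = j := fun s i j hi hj hij =>
      congrArg Subtype.val ((e s).injective (Subtype.ext hij))
    intro i j hij
    have hL : L j = L i := by rw [← hg i, ← hg j, hij]
    refine aux (L i) i j rfl hL (hij.trans ?_)
    change (e (L j) ⟨j, rfl⟩).1 = _
    generalize L i = s at hL
    subst hL
    rfl
  obtain ⟨σ, hσ⟩ := Equiv.Perm.exists_extending_pair (Fin.castLE h) g
    (Fin.castLE_injective h) hinj
  exact ⟨σ, fun j => by rw [hσ, hg]⟩

theorem labelCount_comp_perm {n : ℕ} (L : Fin n → α) (σ : Equiv.Perm (Fin n)) :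
    labelCount (L ∘ σ) = labelCount L := by
  funext s
  refine Finset.card_bij (fun j _ => σ j) ?_ ?_ ?_
  · simp
  · exact fun _ _ _ _ h => σ.injective h
  · exact fun j hj => ⟨σ.symm j, by simpa using hj, by simp⟩

theorem labelCount_eq_iff {n : ℕ} {L L' : Fin n → α} :
    labelCount L = labelCount L' ↔ ∃ σ : Equiv.Perm (Fin n), L' ∘ σ = L :=
  ⟨fun h => (exists_perm_of_labelCount_le le_rfl h.le).imp fun _ hσ => funext hσ,
    fun ⟨σ, hσ⟩ => hσ ▸ labelCount_comp_perm L' σ⟩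

end labelings

theorem ncard_image_eq_ncard_image {α β γ : Type*} {s : Set α} {f : α → β} {g : α → γ}
    (h : ∀ x ∈ s, ∀ y ∈ s, f x = f y ↔ g x = g y) : (f '' s).ncard = (g '' s).ncard := by
  rcases s.eq_empty_or_nonempty with rfl | ⟨x₀, hx₀⟩
  · simp
  have : Nonempty α := ⟨x₀⟩
  have hinv : ∀ x ∈ s, g (Function.invFunOn f s (f x)) = g x := fun x hx =>
    have hx' : f x ∈ f '' s := ⟨x, hx, rfl⟩
    (h _ (Function.invFunOn_mem hx') _ hx).1 (Function.invFunOn_eq hx')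
  refine Set.ncard_congr (fun b _ => g (Function.invFunOn f s b)) ?_ ?_ ?_
  · rintro _ ⟨x, hx, rfl⟩
    exact ⟨x, hx, (hinv x hx).symm⟩
  · rintro _ _ ⟨x, hx, rfl⟩ ⟨y, hy, rfl⟩ hxy
    rw [hinv x hx, hinv y hy] at hxy
    exact (h x hx y hy).2 hxy
  · rintro _ ⟨x, hx, rfl⟩
    exact ⟨f x, ⟨x, hx, rfl⟩, hinv x hx⟩

theorem finite_image_of_finite_image {α β γ : Type*} {s : Set α} {f : α → β} {g : α → γ}
    (h : ∀ x ∈ s, ∀ y ∈ s, g x = g y → f x = f y) (hg : (g '' s).Finite) :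
    (f '' s).Finite := by
  rcases s.eq_empty_or_nonempty with rfl | ⟨x₀, hx₀⟩
  · simp
  have : Nonempty α := ⟨x₀⟩
  refine (hg.image fun b => f (Function.invFunOn g s b)).subset ?_
  rintro _ ⟨x, hx, rfl⟩
  have hx' : g x ∈ g '' s := ⟨x, hx, rfl⟩
  exact ⟨g x, hx', h _ (Function.invFunOn_mem hx') _ hx (Function.invFunOn_eq hx')⟩

/-! ### Covers as column labelings, and orbits as label counts. -/

section columns

variable {k : Type*} [Field k] {c n : ℕ}

/-- The set of variables `x_{i,j}` with `i ∈ L j`. -/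
def columnSet (L : Fin n → Finset (Fin c)) : Finset (Fin c × Fin n) :=
  Finset.univ.filter fun v => v.1 ∈ L v.2

@[simp]
theorem mem_columnSet {L : Fin n → Finset (Fin c)} {v : Fin c × Fin n} :
    v ∈ columnSet L ↔ v.1 ∈ L v.2 := by
  simp [columnSet]

theorem columnSet_injective :
    Function.Injective (columnSet : (Fin n → Finset (Fin c)) → _) := by
  intro L L' h
  funext j
  ext i
  simpa using Finset.ext_iff.1 h (i, j)

theorem columnSet_surjective :
    Function.Surjective (columnSet : (Fin n → Finset (Fin c)) → _) := fun C =>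
  ⟨fun j => Finset.univ.filter fun i => (i, j) ∈ C, by ext v; simp⟩

theorem card_columnSet_compl (L : Fin n → Finset (Fin c)) :
    (columnSet L)ᶜ.card = ∑ s, labelCount L s * (c - s.card) := by
  rw [sum_labelCount_mul]
  have : (columnSet L)ᶜ = Finset.univ.filter fun v : Fin c × Fin n => v.1 ∉ L v.2 := by
    ext v; simp
  rw [this, Finset.card_filter, Fintype.sum_prod_type_right]
  refine Finset.sum_congr rfl fun j _ => ?_
  rw [← Finset.card_filter]
  have : (Finset.univ.filter fun i => i ∉ L j) = (L j)ᶜ := by ext i; simp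
  simp [this, Finset.card_compl]

theorem map_act_varIdeal (σ : Equiv.Perm (Fin n)) (L : Fin n → Finset (Fin c)) :
    (varIdeal k (columnSet (L ∘ σ))ᶜ).map (act k c σ) = varIdeal k (columnSet L)ᶜ := by
  have h : (varIdeal k (columnSet (L ∘ σ))ᶜ).map (act k c σ) = _ :=
    varIdeal_map_rename (k := k) (Equiv.prodCongr (Equiv.refl (Fin c)) σ) _
  rw [h]
  congr 1
  ext ⟨i, j⟩
  simp [Finset.mem_map_equiv]

theorem idealOrbit_varIdeal_eq_iff {L L' : Fin n → Finset (Fin c)} :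
    idealOrbit (varIdeal k (columnSet L)ᶜ) = idealOrbit (varIdeal k (columnSet L')ᶜ) ↔
      labelCount L = labelCount L' := by
  have horb : ∀ L : Fin n → Finset (Fin c), idealOrbit (varIdeal k (columnSet L)ᶜ) =
      {P | ∃ L', labelCount L' = labelCount L ∧ varIdeal k (columnSet L')ᶜ = P} := by
    intro L
    ext P
    constructor
    · rintro ⟨σ, rfl⟩
      refine ⟨L ∘ σ.symm, labelCount_comp_perm _ _, ?_⟩
      change _ = (varIdeal k (columnSet L)ᶜ).map (act k c σ)
      rw [← map_act_varIdeal σ, Function.comp_assoc, Equiv.symm_comp_self, Function.comp_id]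
    · rintro ⟨L', hL', rfl⟩
      obtain ⟨σ, rfl⟩ := labelCount_eq_iff.1 hL'.symm
      exact ⟨σ, map_act_varIdeal σ L'⟩
  rw [horb, horb]
  constructor
  · intro h
    have : varIdeal k (columnSet L)ᶜ ∈
        {P | ∃ L'', labelCount L'' = labelCount L' ∧ varIdeal k (columnSet L'')ᶜ = P} :=
      h ▸ ⟨L, rfl, rfl⟩
    obtain ⟨L'', h1, h2⟩ := this
    rw [← columnSet_injective (compl_injective (varIdeal_injective h2)), h1]
  · intro h
    rw [h]

/-- The label counts of the squarefree monomials lying in the ideals of a chain. -/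
def monomialCounts (I : (n : ℕ) → Ideal (PolyRing k c n)) : Set (Finset (Fin c) → ℕ) :=
  {a | ∃ m, 1 ≤ m ∧ ∃ L : Fin m → Finset (Fin c), labelCount L = a ∧
    ∏ v ∈ columnSet L, (X v : PolyRing k c m) ∈ I m}

variable {I : (n : ℕ) → Ideal (PolyRing k c n)}

/-- Some permutation carries the columns of `L` to equally labeled columns of `L'`, so the moved
monomial, which lies in `I n`, divides the larger one. -/
theorem prod_columnSet_mem_of_labelCount_le (hI : IsSymInvariantChain I) {m : ℕ} (hm : 1 ≤ m)
    {L : Fin m → Finset (Fin c)} {L' : Fin n → Finset (Fin c)}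
    (hle : labelCount L ≤ labelCount L')
    (hL : ∏ v ∈ columnSet L, (X v : PolyRing k c m) ∈ I m) :
    ∏ v ∈ columnSet L', (X v : PolyRing k c n) ∈ I n := by
  have hmn : m ≤ n := by
    rw [← sum_labelCount L, ← sum_labelCount L']
    exact Finset.sum_le_sum fun s _ => hle s
  obtain ⟨σ, hσ⟩ := exists_perm_of_labelCount_le hmn hle
  refine Ideal.mem_of_dvd _ ?_ (hI m n hmn hm σ _ hL)
  have himg : act k c σ (incl k c hmn (∏ v ∈ columnSet L, X v)) =
      ∏ v ∈ (columnSet L).image (fun v => (v.1, σ (Fin.castLE hmn v.2))), X v := by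
    rw [Finset.prod_image]
    · simp [act, incl, map_prod, Prod.map]
    · rintro ⟨i, j⟩ _ ⟨i', j'⟩ _ h
      simpa using h
  rw [himg]
  refine Finset.prod_dvd_prod_of_subset _ _ _ fun v hv => ?_
  obtain ⟨u, hu, rfl⟩ := Finset.mem_image.1 hv
  rw [mem_columnSet] at hu ⊢
  rwa [hσ]

theorem labelCount_mem_monomialCounts (hI : IsSymInvariantChain I) (hn : 1 ≤ n)
    (L : Fin n → Finset (Fin c)) : labelCount L ∈ monomialCounts I ↔
      ∏ v ∈ columnSet L, (X v : PolyRing k c n) ∈ I n :=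
  ⟨fun ⟨_, hm, _, hle, hmem⟩ => prod_columnSet_mem_of_labelCount_le hI hm hle.le hmem,
    fun h => ⟨n, hn, L, rfl, h⟩⟩

theorem isUpperSet_monomialCounts (hI : IsSymInvariantChain I) :
    IsUpperSet (monomialCounts I) := by
  rintro a b hab ⟨m, hm, L, rfl, hL⟩
  obtain ⟨L', hL'⟩ := exists_labelCount_eq b
  refine ⟨_, ?_, L', hL', prod_columnSet_mem_of_labelCount_le hI hm (hL'.symm ▸ hab) hL⟩
  have := Finset.sum_le_sum fun s (_ : s ∈ Finset.univ) => hab s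
  rw [sum_labelCount] at this
  omega

/-- The column labelings, up to complement, of the minimal vertex covers of least size. -/
def minCoverLabelings (I : Ideal (PolyRing k c n)) : Set (Fin n → Finset (Fin c)) :=
  {L | I ≤ varIdeal k (columnSet L)ᶜ ∧ ∀ L' : Fin n → Finset (Fin c),
    I ≤ varIdeal k (columnSet L')ᶜ → (columnSet L)ᶜ.card ≤ (columnSet L')ᶜ.card}

theorem minHeightComponents_eq_image {I : Ideal (PolyRing k c n)} (hI : IsSquarefreeMonomial I) :
    minHeightComponents I =
      (fun L => varIdeal k (columnSet L)ᶜ) '' minCoverLabelings I := by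
  obtain ⟨S, hS⟩ := hI
  have hsurj : Function.Surjective fun L : Fin n → Finset (Fin c) => (columnSet L)ᶜ :=
    compl_surjective.comp columnSet_surjective
  ext P
  refine (associated_height_eq_iff hS P).trans ?_
  simp only [hsurj.exists, hsurj.forall]
  exact exists_congr fun L => and_comm

theorem labelCount_image_minCoverLabelings (hI : IsSymInvariantChain I) (hn : 1 ≤ n)
    (hsq : IsSquarefreeMonomial (I n)) :
    labelCount '' minCoverLabelings (I n) =
      {a | a ∉ monomialCounts I ∧ ∑ s, a s = n ∧ ∀ b ∉ monomialCounts I, ∑ s, b s = n →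
        ∑ s, a s * (c - s.card) ≤ ∑ s, b s * (c - s.card)} := by
  obtain ⟨S, hS⟩ := hsq
  have hle : ∀ L : Fin n → Finset (Fin c),
      I n ≤ varIdeal k (columnSet L)ᶜ ↔ labelCount L ∉ monomialCounts I := fun L => by
    rw [le_varIdeal_iff hS, compl_compl, labelCount_mem_monomialCounts hI hn]
  have hmin : ∀ L, L ∈ minCoverLabelings (I n) ↔ labelCount L ∉ monomialCounts I ∧
      ∀ L' : Fin n → Finset (Fin c), labelCount L' ∉ monomialCounts I →
        ∑ s, labelCount L s * (c - s.card) ≤ ∑ s, labelCount L' s * (c - s.card) := fun L => by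
    simp only [minCoverLabelings, Set.mem_ofPred_eq, hle, card_columnSet_compl]
  ext a
  constructor
  · rintro ⟨L, hL, rfl⟩
    obtain ⟨h1, h2⟩ := (hmin L).1 hL
    refine ⟨h1, sum_labelCount L, fun b hb hbn => ?_⟩
    subst hbn
    obtain ⟨L', hL'⟩ := exists_labelCount_eq b
    simpa only [hL'] using h2 L' (hL'.symm ▸ hb)
  · rintro ⟨h1, rfl, h2⟩
    obtain ⟨L, hL⟩ := exists_labelCount_eq a
    refine ⟨L, (hmin L).2 ⟨hL.symm ▸ h1, fun L' hL' => ?_⟩, hL⟩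
    rw [hL]
    exact h2 _ hL' (sum_labelCount L')

end columns

end SymChain

theorem mainTheorem10 {k : Type*} [Field k] (c : ℕ) (hc : 1 ≤ c)
    (I : (n : ℕ) → Ideal (SymChain.PolyRing k c n))
    (hchain : SymChain.IsSymInvariantChain I)
    (hsq : ∀ n : ℕ, 1 ≤ n → SymChain.IsSquarefreeMonomial (I n)) :
    ∃ p : Polynomial ℚ, ∃ N : ℕ, ∀ n : ℕ, N ≤ n →
      (SymChain.minHeightComponentOrbits (I n)).Finite ∧
      ((SymChain.minHeightComponentOrbits (I n)).ncard : ℚ) = p.eval (n : ℚ) := by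
  obtain ⟨p, N, h⟩ := SymChain.exists_polynomial_card_minimal_weight
    (SymChain.isUpperSet_monomialCounts hchain) fun s => c - s.card
  -- The hypotheses say nothing about `I 0`.
  refine ⟨p, max N 1, fun n hn => ?_⟩
  have hn1 : 1 ≤ n := le_of_max_le_right hn
  have hp := h n (le_of_max_le_left hn)
  rw [← SymChain.labelCount_image_minCoverLabelings hchain hn1 (hsq n hn1)] at hp
  rw [SymChain.minHeightComponentOrbits, SymChain.minHeightComponents_eq_image (hsq n hn1),
    Set.image_image]
  refine ⟨SymChain.finite_image_of_finite_image
    (fun _ _ _ _ => SymChain.idealOrbit_varIdeal_eq_iff.2) hp.1, ?_⟩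
  rw [← hp.2, SymChain.ncard_image_eq_ncard_image
    fun _ _ _ _ => SymChain.idealOrbit_varIdeal_eq_iff]
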